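/- Setting. Let $\alpha>0$, let $L_1,\dots,L_K:\mathbb R^d\to\mathbb R$ be client losses with likelihoods $p_m=\exp(-\alpha^{-1}L_m)$, and write $\mathrm{KL}(q\|p)=\int q\log(q/p)$ (with $p$ possibly unnormalised). For a prior density $p_0$ the global free energy is $F(q)=\sum_{m=1}^K\mathbb E_q[L_m]+\alpha\,\mathrm{KL}(q\|p_0)$. Let $\mathcal H$ be a reproducing kernel Hilbert space on $\mathbb R^d$ whose kernel $\mathrm k$ is $C^2$ and bounded together with its derivatives of order at most two. Let $q=q^{[l]}>0$ be a probability density on $\mathbb R^d$ with $q\log q$ integrable, and assume that each $L_m$ is $C^2$, that $L_m$ and $\nabla L_m$ are $q$-integrable, and that for some $r>0$ and some $q$-integrable $G_m$ one has $\|\nabla^2L_m(\theta+h)\|\le G_m(\theta)$ for all $\theta$ and all $\|h\|\le r$. For each client $m$ let $$\phi_m=\mathbb E_{\theta\sim q}\big[\nabla\log p_m(\theta)\,\mathrm k(\theta,\cdot)+\nabla_\theta \mathrm k(\theta,\cdot)\big]\in\mathcal H^d$$ be the SVGD update function for the likelihood of client $m$. Let client $k$ be the selected client. Claim. There are $\epsilon_0>0$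 and $B\in\mathbb R$, depending only on $q$, $\alpha$, $(L_m)_m$, $\mathrm k$ and the client $k$, such that for all $0<\epsilon<\epsilon_0$ the following holds. The image of $q$ under the SVGD step $T(\theta)=\theta+\epsilon\phi_k(\theta)$ has an everywhere positive density; let $q^{[l+1]}$ be such a density. Let $p_0>0$ be any prior probability density and let $t_1^{(i-1)},\dots,t_K^{(i-1)}>0$ be any measurable functions for which $q^{(i-1)}=p_0\prod_{m}t_m^{(i-1)}$ is a probability density and $\mathrm{KL}(q^{[l]}\|p_0)$ and all the $\mathrm{KL}(q^{[l]}\|t_m^{(i-1)})$ are finite. Put $t_k=\frac{q^{[l+1]}}{q^{(i-1)}}\,t_k^{(i-1)}$ and $t_m=t_m^{(i-1)}$ for $m\ne k$, and suppose that $C_1,\dots,C_K$ are normalising constants, $\int t_m(\theta)/C_m\,d\theta=1$, with $C=\prod_{m=1}^KC_m$. Then $F(q^{[l+1]})$ is finite and $$\frac{F(q^{[l+1]})-F(q^{[l]})}{\alpha}\le-\epsilon\sum_{m=1}^K\langle\phi_k,\phi_m\rangle_{\mathcal H^d}+\sum_{m=1}^K\mathrm{KL}\big(q^{[l]}\,\big\|\,t_m^{(i-1)}\big)+\log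 C+B\epsilon^2 .$$ -/

import Mathlib

open MeasureTheory

noncomputable section

namespace FedBayes

/-- The parameter space `ℝ^d` with its Euclidean norm. -/
abbrev Param (d : ℕ) := EuclideanSpace ℝ (Fin d)

/-! ### Densities, divergences and free energies -/

/-- A (measurable, everywhere positive) probability density with respect to Lebesgue measure. -/
structure IsPosDensity {d : ℕ} (q : Param d → ℝ) : Prop where
  measurable : Measurable q
  pos : ∀ θ, 0 < q θ
  integral_eq_one : ∫ θ, q θ = 1

/-- The measure `q(θ) dθ`. -/
def densityMeasure {d : ℕ} (q : Param d → ℝ) : Measure (Param d) :=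
  volume.withDensity fun θ => ENNReal.ofReal (q θ)

/-- `KL(q ‖ p) = E_q[log (q / p)]`; the second argument need not be normalised. -/
def KL {d : ℕ} (q p : Param d → ℝ) : ℝ :=
  ∫ θ, q θ * Real.log (q θ / p θ)

/-- `KL(q ‖ p)` is well defined and finite. -/
def KLFinite {d : ℕ} (q p : Param d → ℝ) : Prop :=
  Integrable fun θ => q θ * Real.log (q θ / p θ)

/-- The global free energy `F(q) = ∑ₘ E_q[Lₘ] + α KL(q ‖ p₀)`. -/
def freeEnergy {d K : ℕ} (α : ℝ) (L : Fin K → Param d → ℝ) (p₀ q : Param d → ℝ) : ℝ :=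
  (∑ m, ∫ θ, q θ * L m θ) + α * KL q p₀

/-- All the terms of the global free energy `F(q)` are well defined and finite. -/
def FreeEnergyFinite {d K : ℕ} (L : Fin K → Param d → ℝ) (p₀ q : Param d → ℝ) : Prop :=
  (∀ m, Integrable fun θ => q θ * L m θ) ∧ KLFinite q p₀

/-- The local likelihood `p = exp(-α⁻¹ L)` of a client with loss `L`. -/
def likelihood {d : ℕ} (α : ℝ) (L : Param d → ℝ) (θ : Param d) : ℝ :=
  Real.exp (-(α⁻¹ * L θ))

/-- `p₀ ∏ₘ tₘ`, the global posterior with approximate scaled local likelihoods `tₘ`. -/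
def globalPosterior {d K : ℕ} (p₀ : Param d → ℝ) (t : Fin K → Param d → ℝ) (θ : Param d) : ℝ :=
  p₀ θ * ∏ m, t m θ

/-- The factors after client `k` has moved the global posterior from `p₀ ∏ₘ tₘ` to `q'`:
`t_k` is replaced by `(q' / (p₀ ∏ₘ tₘ)) t_k`, the other factors are kept. -/
def updateFactors {d K : ℕ} (p₀ : Param d → ℝ) (t : Fin K → Param d → ℝ) (k : Fin K)
    (q' : Param d → ℝ) : Fin K → Param d → ℝ :=
  Function.update t k fun θ => q' θ / globalPosterior p₀ t θ * t k θ

/-! ### The RKHS and the SVGD update functions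

`H` is a reproducing kernel Hilbert space of real functions on `ℝ^d`. -/

section RKHSpart

variable {d : ℕ} (H : Type*) [NormedAddCommGroup H] [InnerProductSpace ℝ H] [CompleteSpace H]
  [RKHS ℝ H (Param d) ℝ]

/-- The element `k(θ, ·)` of `H`. -/
def kernelSection (θ : Param d) : H := RKHS.kerFun H θ 1

/-- The scalar kernel `k(θ, θ')` of `H`. -/
def scalarKernel (θ θ' : Param d) : ℝ := RKHS.kernel H θ θ' 1

/-- The kernel is twice continuously differentiable on `ℝ^d × ℝ^d`, and it is bounded together
with its derivatives of order at most two. -/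
def RegularKernel : Prop :=
  ContDiff ℝ 2 (fun z : Param d × Param d => scalarKernel H z.1 z.2) ∧
    ∃ M : ℝ, ∀ i : ℕ, i ≤ 2 → ∀ z : Param d × Param d,
      ‖iteratedFDeriv ℝ i (fun z : Param d × Param d => scalarKernel H z.1 z.2) z‖ ≤ M

/-- The Hilbert space `H^d` of vector fields with components in `H`, with inner product
`⟨f, g⟩ = ∑ⱼ ⟨fⱼ, gⱼ⟩_H`. -/
abbrev VectorRKHS (d : ℕ) (H : Type*) := PiLp 2 fun _ : Fin d => H

/-- The SVGD update function for the target `p` at the distribution `q`: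
`φ = E_{θ ∼ q}[∇ log p(θ) k(θ, ·) + ∇_θ k(θ, ·)]`, an element of `H^d`; the expectation of each
component is a Bochner integral in `H`. -/
def svgdUpdate (q p : Param d → ℝ) : VectorRKHS d H :=
  WithLp.toLp 2 fun j => ∫ θ, q θ •
    (fderiv ℝ (fun ϑ => Real.log (p ϑ)) θ (EuclideanSpace.single j 1) • kernelSection H θ
      + fderiv ℝ (fun ϑ => kernelSection H ϑ) θ (EuclideanSpace.single j 1))

variable {H}

/-- An element of `H^d` as a vector field on `ℝ^d`. -/
def vectorField (φ : VectorRKHS d H) (θ : Param d) : Param d :=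
  WithLp.toLp 2 fun j => (φ j : H) θ

/-- One SVGD step: `T(θ) = θ + ε φ(θ)`. -/
def svgdStep (ε : ℝ) (φ : VectorRKHS d H) (θ : Param d) : Param d :=
  θ + ε • vectorField φ θ

end RKHSpart

/-- `q'` is a positive density of the image under `T` of the distribution with density `q`. -/
def IsPushforwardDensity {d : ℕ} (T : Param d → Param d) (q q' : Param d → ℝ) : Prop :=
  IsPosDensity q' ∧ (densityMeasure q).map T = densityMeasure q'

/-- The loss `L` is admissible for `q`: it is `C²`, `L` and `∇L` are `q`-integrable, and for some
radius `r > 0` the Hessians on the balls `B(θ, r)` are bounded by a `q`-integrable function of `θ`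
(for instance, the Hessian of `L` is bounded). -/
structure AdmissibleLoss {d : ℕ} (q L : Param d → ℝ) : Prop where
  contDiff : ContDiff ℝ 2 L
  integrable : Integrable fun θ => q θ * L θ
  integrable_fderiv : Integrable fun θ => q θ * ‖fderiv ℝ L θ‖
  hessian_dominated : ∃ r : ℝ, 0 < r ∧ ∃ G : Param d → ℝ,
    (Integrable fun θ => q θ * G θ) ∧
      ∀ θ h : Param d, ‖h‖ ≤ r → ‖iteratedFDeriv ℝ 2 L (θ + h)‖ ≤ G θ

end FedBayes

end

/-! Write Q for the old posterior `p₀ ∏ₘ tₘ` and Ent(q) for ∫ q log q. Two uses of Gibbs' inequality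
turn the KL terms into K copies of the entropy. First, KL(q‖p₀) + ∑ KL(q‖tₘ) equals K·Ent(q) +
KL(q‖Q), hence is at least K·Ent(q) (`card_mul_entropy_le`). Second, q' is p₀ times the updated
factors, so KL(q'‖p₀) is the sum of the q'-expectations of their logarithms; comparing q' with each
normalised factor bounds it by K·Ent(q') + log C (`KL_le_card_mul_entropy_add_log`). The KL part of
the free energy therefore grows by at most K(Ent(q') - Ent(q)) + ∑ KL(q‖tₘ) + log C.

The rest is first-order calculus along the step. The losses change by ε E_q[∇Lₘ·φₖ] + O(ε²) and the
entropy by -ε E_q[div φₖ] + O(ε²), through log det(1 + εA) = ε tr A + O(ε²). By `inner_svgdUpdate`,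
⟨φₖ, φₘ⟩ = -α⁻¹ E_q[∇Lₘ·φₖ] + E_q[div φₖ]; summed over m, this contains the divergence exactly K
times, matching the K entropies.

The analytic prerequisite is that θ ↦ k(θ, ·) is Fréchet differentiable into H with bounded
derivative, which is deduced from the C² kernel. -/

open MeasureTheory

noncomputable section

namespace FedBayes

/-! ### Differentiability of the feature map of a C² kernel -/

section FeatureMap

variable {E : Type*} [NormedAddCommGroup E] [NormedSpace ℝ E]

/-- The mixed second derivative of a function of two variables at `(x, x)`. -/
def mixedDeriv (κ : E × E → ℝ) (x u v : E) : ℝ :=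
  fderiv ℝ (fderiv ℝ κ) (x, x) (u, 0) (0, v)

lemma mixedDeriv_add_left (κ : E × E → ℝ) (x u u' v : E) :
    mixedDeriv κ x (u + u') v = mixedDeriv κ x u v + mixedDeriv κ x u' v := by
  have : ((u + u', 0) : E × E) = (u, 0) + (u', 0) := by simp
  simp only [mixedDeriv]
  rw [this]
  simp only [map_add, add_apply]

lemma mixedDeriv_add_right (κ : E × E → ℝ) (x u v v' : E) :
    mixedDeriv κ x u (v + v') = mixedDeriv κ x u v + mixedDeriv κ x u v' := by
  have : ((0, v + v') : E × E) = (0, v) + (0, v') := by simp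
  simp only [mixedDeriv]
  rw [this]
  simp only [map_add]

lemma mixedDeriv_smul_left (κ : E × E → ℝ) (x u v : E) (c : ℝ) :
    mixedDeriv κ x (c • u) v = c * mixedDeriv κ x u v := by
  have : ((c • u, 0) : E × E) = c • (u, 0) := by simp
  simp only [mixedDeriv]
  rw [this]
  simp only [map_smul, smul_apply, smul_eq_mul]

lemma mixedDeriv_smul_right (κ : E × E → ℝ) (x u v : E) (c : ℝ) :
    mixedDeriv κ x u (c • v) = c * mixedDeriv κ x u v := by
  have : ((0, c • v) : E × E) = c • (0, v) := by simp
  simp only [mixedDeriv]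
  rw [this]
  simp only [map_smul, smul_eq_mul]

lemma abs_mixedDeriv_le (κ : E × E → ℝ) (x u v : E) :
    |mixedDeriv κ x u v| ≤ ‖fderiv ℝ (fderiv ℝ κ) (x, x)‖ * ‖u‖ * ‖v‖ := by
  have h := (fderiv ℝ (fderiv ℝ κ) (x, x)).le_opNorm₂ (u, 0) (0, v)
  simpa [mixedDeriv, Prod.norm_def] using h

/-- Mixed second differences of a `C²` function are approximated by its mixed derivative. -/
lemma exists_mixed_difference_le {κ : E × E → ℝ} (hκ : ContDiff ℝ 2 κ) (x : E) {η : ℝ}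
    (hη : 0 < η) :
    ∃ δ > 0, ∀ a ∈ Metric.ball x δ, ∀ b ∈ Metric.ball x δ, ∀ c ∈ Metric.ball x δ,
      ∀ e ∈ Metric.ball x δ,
      |κ (a, c) - κ (a, e) - κ (b, c) + κ (b, e) - mixedDeriv κ x (a - b) (c - e)|
        ≤ η * ‖a - b‖ * ‖c - e‖ := by
  have hκ' : ContDiff ℝ 1 (fderiv ℝ κ) := hκ.fderiv_right (by norm_num)
  have hs : HasStrictFDerivAt (fderiv ℝ κ) (fderiv ℝ (fderiv ℝ κ) (x, x)) (x, x) :=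
    hκ'.contDiffAt.hasStrictFDerivAt (by norm_num)
  have hd : Differentiable ℝ κ := hκ.differentiable (by norm_num)
  have := hs.isLittleO.def hη
  obtain ⟨δ, hδ, h⟩ := Metric.eventually_nhds_iff.1 this
  refine ⟨δ, hδ, fun a ha b hb c hc e he => ?_⟩
  -- Strict differentiability at the diagonal point compares two nearby points, neither of which is
  -- the base point. The mean value inequality in the second variable then produces the factor ‖c -
  -- e‖.
  have key : ∀ y ∈ Metric.ball x δ, ‖fderiv ℝ κ (a, y) - fderiv ℝ κ (b, y)
      - fderiv ℝ (fderiv ℝ κ) (x, x) (a - b, 0)‖ ≤ η * ‖a - b‖ := by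
    intro y hy
    have := @h ((a, y), (b, y)) (by
      simp only [Metric.mem_ball] at ha hb hy
      simp [Prod.dist_eq, ha, hb, hy])
    simpa [Prod.norm_def] using this
  have hder : ∀ y ∈ Metric.ball x δ, HasFDerivWithinAt
      (fun y => κ (a, y) - κ (b, y) - fderiv ℝ (fderiv ℝ κ) (x, x) (a - b, 0) (0, y))
      ((fderiv ℝ κ (a, y) - fderiv ℝ κ (b, y)
        - fderiv ℝ (fderiv ℝ κ) (x, x) (a - b, 0)).comp (ContinuousLinearMap.inr ℝ E E))
      (Metric.ball x δ) y := by
    intro y _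
    have h1 : ∀ a : E, HasFDerivAt (fun y => κ (a, y))
        ((fderiv ℝ κ (a, y)).comp (ContinuousLinearMap.inr ℝ E E)) y := fun a =>
      HasFDerivAt.comp y (hd (a, y)).hasFDerivAt (hasFDerivAt_prodMk_right a y)
    have h2 := ((fderiv ℝ (fderiv ℝ κ) (x, x) (a - b, 0)).comp
      (ContinuousLinearMap.inr ℝ E E)).hasFDerivAt (x := y)
    have := ((h1 a).sub (h1 b)).sub h2
    simp only [ContinuousLinearMap.sub_comp]
    exact this.hasFDerivWithinAt
  have hb' : ∀ y ∈ Metric.ball x δ, ‖(fderiv ℝ κ (a, y) - fderiv ℝ κ (b, y)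
        - fderiv ℝ (fderiv ℝ κ) (x, x) (a - b, 0)).comp (ContinuousLinearMap.inr ℝ E E)‖
      ≤ η * ‖a - b‖ := by
    intro y hy
    refine (ContinuousLinearMap.opNorm_comp_le _ _).trans ?_
    calc _ ≤ (η * ‖a - b‖) * 1 := by
          gcongr
          · exact key y hy
          · exact ContinuousLinearMap.norm_inr_le_one ℝ E E
      _ = _ := mul_one _
  have := (convex_ball x δ).norm_image_sub_le_of_norm_hasFDerivWithin_le hder hb' he hc
  rw [Real.norm_eq_abs] at this
  convert this using 2
  have h3 : ((0, c - e) : E × E) = (0, c) - (0, e) := by simp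
  simp only [mixedDeriv, h3, map_sub]
  ring

variable {H : Type*} [NormedAddCommGroup H] [InnerProductSpace ℝ H]

lemma norm_sub_sq_eq_inner (a b : H) :
    ‖a - b‖ ^ 2 = inner ℝ a a - 2 * inner ℝ a b + inner ℝ b b := by
  rw [norm_sub_sq_real, real_inner_self_eq_norm_sq, real_inner_self_eq_norm_sq]

/-- Translates kernel estimates into H: mixed second differences of the kernel are inner products of
feature increments. -/
lemma inner_sub_sub_eq {X : Type*} (Φ : X → H) (κ : X × X → ℝ)
    (h : ∀ x y, inner ℝ (Φ x) (Φ y) = κ (x, y))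
    (a b c e : X) :
    inner ℝ (Φ a - Φ b) (Φ c - Φ e) = κ (a, c) - κ (a, e) - κ (b, c) + κ (b, e) := by
  simp only [inner_sub_left, inner_sub_right, h]
  ring

/-- A feature map of a `C²` kernel is Fréchet differentiable, and the Gram matrix of its derivative
is the mixed second derivative of the kernel. -/
theorem exists_hasFDerivAt_featureMap [CompleteSpace H] {Φ : E → H} {κ : E × E → ℝ}
    (hκ : ContDiff ℝ 2 κ) (h : ∀ x y, inner ℝ (Φ x) (Φ y) = κ (x, y)) (x : E) :
    ∃ D : E →L[ℝ] H, HasFDerivAt Φ D x ∧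
      ∀ u v, inner ℝ (D u) (D v) = mixedDeriv κ x u v := by
  set s : ℕ → ℝ := fun n => 1 / ((n : ℝ) + 1) with hs_def
  have hs_pos : ∀ n, 0 < s n := fun n => by simp only [hs_def]; positivity
  have hs : Filter.Tendsto s Filter.atTop (nhds 0) := tendsto_one_div_add_atTop_nhds_zero_nat
  set Δ : E → ℕ → H := fun u n => (s n)⁻¹ • (Φ (x + s n • u) - Φ x) with hΔ
  have hball : ∀ (u : E) {δ : ℝ}, 0 < δ → ∀ᶠ n in Filter.atTop, x + s n • u ∈ Metric.ball x δ := by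
    intro u δ hδ
    have : Filter.Tendsto (fun n => x + s n • u) Filter.atTop (nhds (x + (0 : ℝ) • u)) :=
      tendsto_const_nhds.add (hs.smul_const u)
    rw [zero_smul, add_zero] at this
    exact this (Metric.ball_mem_nhds x hδ)
  -- Here δ is chosen before v, and the bound scales with ‖v‖. This uniformity later allows v = a -
  -- x.
  have inc : ∀ {η : ℝ}, 0 < η → ∃ δ > 0, ∀ a ∈ Metric.ball x δ, ∀ v : E, ∀ n : ℕ,
      x + s n • v ∈ Metric.ball x δ →
      |inner ℝ (Φ a - Φ x) (Δ v n) - mixedDeriv κ x (a - x) v| ≤ η * ‖a - x‖ * ‖v‖ := by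
    intro η hη
    obtain ⟨δ, hδ, hb⟩ := exists_mixed_difference_le hκ x hη
    refine ⟨δ, hδ, fun a ha v n hn => ?_⟩
    have := hb a ha x (Metric.mem_ball_self hδ) _ hn x (Metric.mem_ball_self hδ)
    rw [← inner_sub_sub_eq Φ κ h, add_sub_cancel_left, mixedDeriv_smul_right, norm_smul,
      Real.norm_of_nonneg (hs_pos n).le] at this
    have e : inner ℝ (Φ a - Φ x) (Φ (x + s n • v) - Φ x) = s n * inner ℝ (Φ a - Φ x) (Δ v n) := by
      simp only [hΔ, inner_smul_right]
      field_simp [(hs_pos n).ne']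
    rw [e, ← mul_sub, abs_mul, abs_of_pos (hs_pos n)] at this
    have h2 : s n * |inner ℝ (Φ a - Φ x) (Δ v n) - mixedDeriv κ x (a - x) v|
      ≤ s n * (η * ‖a - x‖ * ‖v‖) := by linarith
    exact le_of_mul_le_mul_left h2 (hs_pos n)
  have quot : ∀ (u v : E) {η : ℝ}, 0 < η → ∃ N, ∀ n ≥ N, ∀ m ≥ N,
      |inner ℝ (Δ u n) (Δ v m) - mixedDeriv κ x u v| ≤ η := by
    intro u v η hη
    -- The added 1 covers u = 0 or v = 0.
    have hη' : 0 < η / (‖u‖ * ‖v‖ + 1) := by positivity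
    obtain ⟨δ, hδ, hb⟩ := inc hη'
    obtain ⟨N, hN⟩ := Filter.eventually_atTop.1 ((hball u hδ).and (hball v hδ))
    refine ⟨N, fun n hn m hm => ?_⟩
    have := hb _ (hN n hn).1 v m (hN m hm).2
    rw [add_sub_cancel_left, mixedDeriv_smul_left, norm_smul,
      Real.norm_of_nonneg (hs_pos n).le] at this
    have e : inner ℝ (Φ (x + s n • u) - Φ x) (Δ v m) = s n * inner ℝ (Δ u n) (Δ v m) := by
      simp only [hΔ, inner_smul_left, RCLike.conj_to_real]
      field_simp [(hs_pos n).ne']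
    rw [e, ← mul_sub, abs_mul, abs_of_pos (hs_pos n)] at this
    have h2 : s n * |inner ℝ (Δ u n) (Δ v m) - mixedDeriv κ x u v|
      ≤ s n * (η / (‖u‖ * ‖v‖ + 1) * (‖u‖ * ‖v‖)) := by linarith
    refine (le_of_mul_le_mul_left h2 (hs_pos n)).trans ?_
    rw [div_mul_eq_mul_div]
    refine div_le_of_le_mul₀ (by positivity) hη.le ?_
    nlinarith [mul_nonneg (norm_nonneg u) (norm_nonneg v)]
  have cauchy : ∀ u, CauchySeq (Δ u) := by
    intro u
    rw [Metric.cauchySeq_iff]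
    intro η hη
    -- In the expansion of ‖Δₘ - Δₙ‖² the inner products have coefficients 1, -2, 1 and nearly equal
    -- values, so the error is at most 4 · η²/8 < η².
    obtain ⟨N, hN⟩ := quot u u (η := η ^ 2 / 8) (by positivity)
    refine ⟨N, fun m hm n hn => ?_⟩
    have h1 := abs_le.1 (hN m hm m hm)
    have h2 := abs_le.1 (hN m hm n hn)
    have h3 := abs_le.1 (hN n hn n hn)
    have h4 := norm_sub_sq_eq_inner (Δ u m) (Δ u n)
    rw [dist_eq_norm]
    refine lt_of_pow_lt_pow_left₀ 2 hη.le ?_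
    nlinarith [sq_pos_of_pos hη]
  choose W hW using fun u => cauchySeq_tendsto_of_complete (cauchy u)
  have gram : ∀ u v, inner ℝ (W u) (W v) = mixedDeriv κ x u v := by
    intro u v
    refine tendsto_nhds_unique ((hW u).inner (𝕜 := ℝ) (hW v)) ?_
    rw [Metric.tendsto_atTop]
    intro η hη
    obtain ⟨N, hN⟩ := quot u v (half_pos hη)
    exact ⟨N, fun n hn => by
      rw [Real.dist_eq]
      linarith [hN n hn n hn]⟩
  have incW : ∀ {η : ℝ}, 0 < η → ∃ δ > 0, ∀ a ∈ Metric.ball x δ, ∀ v : E,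
      |inner ℝ (Φ a - Φ x) (W v) - mixedDeriv κ x (a - x) v| ≤ η * ‖a - x‖ * ‖v‖ := by
    intro η hη
    obtain ⟨δ, hδ, hb⟩ := inc hη
    refine ⟨δ, hδ, fun a ha v => ?_⟩
    have ht : Filter.Tendsto (fun n => |inner ℝ (Φ a - Φ x) (Δ v n) - mixedDeriv κ x (a - x) v|)
        Filter.atTop (nhds |inner ℝ (Φ a - Φ x) (W v) - mixedDeriv κ x (a - x) v|) :=
      ((tendsto_const_nhds.inner (hW v)).sub_const _).abs
    exact le_of_tendsto ht ((hball v hδ).mono fun n hn => hb a ha v n hn)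
  -- Linearity is read off the Gram matrix: the defect has squared norm zero because the mixed
  -- derivative is bilinear.
  have hadd : ∀ u v, W (u + v) = W u + W v := by
    intro u v
    rw [← sub_eq_zero, ← inner_self_eq_zero (𝕜 := ℝ)]
    simp only [inner_sub_left, inner_sub_right, inner_add_left, inner_add_right, gram,
      mixedDeriv_add_left, mixedDeriv_add_right]
    ring
  have hsmul : ∀ (c : ℝ) u, W (c • u) = c • W u := by
    intro c u
    rw [← sub_eq_zero, ← inner_self_eq_zero (𝕜 := ℝ)]
    simp only [inner_sub_left, inner_sub_right, inner_smul_left, inner_smul_right, gram,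
      mixedDeriv_smul_left, mixedDeriv_smul_right, RCLike.conj_to_real]
    ring
  let D : E →L[ℝ] H := LinearMap.mkContinuousOfExistsBound
    { toFun := W, map_add' := hadd, map_smul' := hsmul } (by
      refine ⟨√‖fderiv ℝ (fderiv ℝ κ) (x, x)‖, fun u => ?_⟩
      refine le_of_sq_le_sq ?_ (by positivity)
      have := (le_abs_self _).trans (abs_mixedDeriv_le κ x u u)
      rw [← gram, real_inner_self_eq_norm_sq] at this
      rw [mul_pow, Real.sq_sqrt (by positivity)]
      calc _ ≤ _ := this
        _ = _ := by ring)
  have hDW : ∀ u, D u = W u := fun u => rfl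
  refine ⟨D, ?_, fun u v => by rw [hDW, hDW, gram]⟩
  rw [hasFDerivAt_iff_isLittleO, Asymptotics.isLittleO_iff]
  intro η hη
  -- In the squared remainder the cross term counts twice and the increment term once, for a total
  -- of (3/4) η² ‖a - x‖².
  obtain ⟨δ₁, hδ₁, h₁⟩ := incW (η := η ^ 2 / 4) (by positivity)
  obtain ⟨δ₂, hδ₂, h₂⟩ := exists_mixed_difference_le hκ x (η := η ^ 2 / 4) (by positivity)
  filter_upwards [Metric.ball_mem_nhds x hδ₁, Metric.ball_mem_nhds x hδ₂] with a ha₁ ha₂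
  have i₁ := abs_le.1 (h₁ a ha₁ (a - x))
  have i₂ := h₂ a ha₂ x (Metric.mem_ball_self hδ₂) a ha₂ x (Metric.mem_ball_self hδ₂)
  rw [← inner_sub_sub_eq Φ κ h] at i₂
  have i₂ := abs_le.1 i₂
  have e := norm_sub_sq_eq_inner (Φ a - Φ x) (W (a - x))
  rw [gram] at e
  rw [hDW]
  refine le_of_sq_le_sq ?_ (by positivity)
  rw [e, mul_pow]
  nlinarith [sq_nonneg (η * ‖a - x‖)]

end FeatureMap

/-! ### Second-order Taylor bounds -/

section Taylor

variable {E F : Type*} [NormedAddCommGroup E] [NormedSpace ℝ E] [NormedAddCommGroup F]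
  [NormedSpace ℝ F]

lemma norm_sub_sub_le_of_fderiv_lipschitz {f : E → F} {x h : E} {C : ℝ}
    (hf : ∀ y ∈ Metric.closedBall x ‖h‖, DifferentiableAt ℝ f y)
    (hC : 0 ≤ C)
    (hf' : ∀ y ∈ Metric.closedBall x ‖h‖, ‖fderiv ℝ f y - fderiv ℝ f x‖ ≤ C * ‖y - x‖) :
    ‖f (x + h) - f x - fderiv ℝ f x h‖ ≤ C * ‖h‖ ^ 2 := by
  have hx : x ∈ Metric.closedBall x ‖h‖ := Metric.mem_closedBall_self (norm_nonneg h)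
  have hxh : x + h ∈ Metric.closedBall x ‖h‖ := by simp
  have := (convex_closedBall x ‖h‖).norm_image_sub_le_of_norm_fderiv_le' (f := f) (C := C * ‖h‖)
    (φ := fderiv ℝ f x) hf
    (fun y hy => (hf' y hy).trans (by
      rw [mem_closedBall_iff_norm] at hy
      gcongr)) hx hxh
  rw [add_sub_cancel_left] at this
  calc _ ≤ _ := this
    _ = _ := by ring

/-- The second-order Taylor bound for a `C²` function with Hessian bounded on a ball. -/
lemma norm_taylor_le_of_hessian_le {f : E → F} (hf : ContDiff ℝ 2 f) {x : E} {r C : ℝ}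
    (hC : ∀ h : E, ‖h‖ ≤ r → ‖iteratedFDeriv ℝ 2 f (x + h)‖ ≤ C) {h : E} (hh : ‖h‖ ≤ r) :
    ‖f (x + h) - f x - fderiv ℝ f x h‖ ≤ C * ‖h‖ ^ 2 := by
  have hd : Differentiable ℝ f := hf.differentiable (by norm_num)
  have hd' : Differentiable ℝ (fderiv ℝ f) :=
    (hf.fderiv_right (m := 1) (by norm_num)).differentiable (by norm_num)
  refine norm_sub_sub_le_of_fderiv_lipschitz (fun y _ => hd y)
    ((norm_nonneg _).trans (hC h hh)) fun y hy => ?_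
  refine (convex_closedBall x ‖h‖).norm_image_sub_le_of_norm_fderiv_le (f := fderiv ℝ f)
    (fun y _ => hd' y) (fun z hz => ?_) (Metric.mem_closedBall_self (norm_nonneg h)) hy
  have := hC (z - x) ((mem_closedBall_iff_norm.1 hz).trans hh)
  rw [add_sub_cancel] at this
  rwa [← norm_iteratedFDeriv_one, norm_iteratedFDeriv_fderiv]

/-- A function which is `C²` at a point has a second-order Taylor bound near this point. -/
lemma exists_taylor_bound {f : E → F} {x : E} (hf : ContDiffAt ℝ 2 f x) :
    ∃ δ > 0, ∃ C : ℝ, 0 ≤ C ∧ ∀ h : E, ‖h‖ ≤ δ →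
      ‖f (x + h) - f x - fderiv ℝ f x h‖ ≤ C * ‖h‖ ^ 2 := by
  have h1 : ContDiffAt ℝ 1 (fderiv ℝ f) x := hf.fderiv_right (by norm_num)
  obtain ⟨K, t, ht, hK⟩ := h1.exists_lipschitzOnWith
  have h2 : ∀ᶠ y in nhds x, DifferentiableAt ℝ f y :=
    (hf.eventually (by simp)).mono fun y hy => hy.differentiableAt (by norm_num)
  obtain ⟨δ, hδ, hb⟩ := Metric.nhds_basis_closedBall.mem_iff.1 (Filter.inter_mem ht h2)
  refine ⟨δ, hδ, K, K.2, fun h hh => ?_⟩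
  have hsub := Metric.closedBall_subset_closedBall (x := x) hh
  refine norm_sub_sub_le_of_fderiv_lipschitz (fun y hy => (hb (hsub hy)).2) K.2 fun y hy => ?_
  have := hK.dist_le_mul y (hb (hsub hy)).1 x (hb (Metric.mem_closedBall_self hδ.le)).1
  rwa [dist_eq_norm, dist_eq_norm] at this

end Taylor

/-! ### Expansion of log det near the identity -/

section Determinant

variable {d : ℕ}

/-- The matrix of an endomorphism of `ℝ^d`. -/
def coordMatrix (A : Param d →L[ℝ] Param d) : Matrix (Fin d) (Fin d) ℝ :=
  Matrix.of fun i j => A (EuclideanSpace.single j 1) i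

lemma det_one_add_eq (A : Param d →L[ℝ] Param d) :
    (1 + A).det = (1 + coordMatrix A).det := by
  have h : LinearMap.toMatrix (EuclideanSpace.basisFun (Fin d) ℝ).toBasis
      (EuclideanSpace.basisFun (Fin d) ℝ).toBasis ((1 + A : Param d →L[ℝ] Param d) :
        Param d →ₗ[ℝ] Param d) = 1 + coordMatrix A := by
    ext i j
    simp [LinearMap.toMatrix_apply, coordMatrix, Matrix.one_apply]
  rw [← h, LinearMap.det_toMatrix]

lemma contDiff_det_one_add {n : WithTop ℕ∞} :
    ContDiff ℝ n fun A : Param d →L[ℝ] Param d => (1 + A).det := by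
  simp only [det_one_add_eq, Matrix.det_apply]
  refine ContDiff.sum fun σ _ => ContDiff.const_smul _ (contDiff_prod fun i _ => ?_)
  simp only [Matrix.add_apply, coordMatrix, Matrix.of_apply]
  refine contDiff_const.add ?_
  exact ((EuclideanSpace.proj (σ i) : Param d →L[ℝ] ℝ).comp
    (ContinuousLinearMap.apply ℝ (Param d) (EuclideanSpace.single i (1 : ℝ)))).contDiff

/-- The determinant is a polynomial in t of the form 1 + t tr A + t² R(t). -/
lemma hasDerivAt_det_one_add_smul (A : Param d →L[ℝ] Param d) :
    HasDerivAt (fun t : ℝ => (1 + t • A).det) (∑ j, A (EuclideanSpace.single j 1) j) 0 := by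
  have h : ∀ t : ℝ, (1 + t • A).det = 1 + (coordMatrix A).trace * t
      + ((1 + (Polynomial.X : Polynomial ℝ) •
          (coordMatrix A).map Polynomial.C).det.divX.divX).eval t * t ^ 2 := by
    intro t
    rw [det_one_add_eq, ← Matrix.det_one_add_smul]
    rfl
  have key : ∀ (a : ℝ) (p : Polynomial ℝ),
      HasDerivAt (fun t : ℝ => 1 + a * t + p.eval t * t ^ 2) a 0 := by
    intro a p
    have h1 := (((hasDerivAt_id (0 : ℝ)).const_mul a).const_add 1).add
      ((p.hasDerivAt 0).mul ((hasDerivAt_id (0 : ℝ)).pow 2))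
    exact h1.congr_deriv (by simp)
  simp only [h]
  exact key _ _

/-- `log det (1 + A) = tr A + O(‖A‖²)`. -/
lemma exists_abs_log_det_sub_trace_le (d : ℕ) :
    ∃ δ > 0, ∃ C : ℝ, 0 ≤ C ∧ ∀ A : Param d →L[ℝ] Param d, ‖A‖ ≤ δ →
      0 < (1 + A).det ∧
        |Real.log (1 + A).det - ∑ j, A (EuclideanSpace.single j 1) j| ≤ C * ‖A‖ ^ 2 := by
  have h0 : (1 + (0 : Param d →L[ℝ] Param d)).det = 1 := by
    rw [add_zero]; exact LinearMap.det_id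
  have hc : ContDiff ℝ 2 fun A : Param d →L[ℝ] Param d => (1 + A).det := contDiff_det_one_add
  have hl : ContDiffAt ℝ 2 (fun A : Param d →L[ℝ] Param d => Real.log (1 + A).det) 0 :=
    hc.contDiffAt.log (by rw [h0]; exact one_ne_zero)
  obtain ⟨δ₁, hδ₁, C, hC, hb⟩ := exists_taylor_bound hl
  have hpos : ∀ᶠ A : Param d →L[ℝ] Param d in nhds 0, 0 < (1 + A).det :=
    hc.continuous.continuousAt.eventually_mem (by rw [h0]; exact Ioi_mem_nhds one_pos)
  obtain ⟨δ₂, hδ₂, hp⟩ := Metric.nhds_basis_closedBall.eventually_iff.1 hpos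
  refine ⟨min δ₁ δ₂, lt_min hδ₁ hδ₂, C, hC, fun A hA => ⟨hp ?_, ?_⟩⟩
  · simpa using hA.trans (min_le_right _ _)
  · have := hb A (hA.trans (min_le_left _ _))
    rw [zero_add, h0, Real.log_one, sub_zero] at this
    -- The linear Taylor term is identified as the trace by differentiating along the line t ↦ tA in
    -- two ways.
    have hline : HasDerivAt (fun t : ℝ => t • A) A 0 := by
      simpa using (hasDerivAt_id (0 : ℝ)).smul_const A
    have hz' : (0 : ℝ) • A = 0 := zero_smul ℝ A
    have hz : (1 + (0 : ℝ) • A).det = 1 := by rw [hz', h0]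
    have hd := (hl.differentiableAt (by norm_num)).hasFDerivAt
    rw [← hz'] at hd
    have e1 := hd.comp_hasDerivAt (0 : ℝ) hline
    have e2 := (hasDerivAt_det_one_add_smul A).log (by rw [hz]; exact one_ne_zero)
    have e := e1.unique e2
    rw [hz, div_one, hz'] at e
    rwa [e] at this

end Determinant

/-! ### Small perturbations of the identity -/

section Perturbation

variable {E : Type*} [NormedAddCommGroup E] [NormedSpace ℝ E] [CompleteSpace E]

/-- A perturbation of the identity by a strict contraction is a homeomorphism. -/
lemma exists_homeomorph_of_id_add {g : E → E} {c : NNReal} (hg : LipschitzWith c g) (hc : c < 1) :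
    ∃ e : E ≃ₜ E, ∀ x, e x = x + g x := by
  have h : ApproximatesLinearOn (fun x => x + g x)
      ((ContinuousLinearEquiv.refl ℝ E : E ≃L[ℝ] E) : E →L[ℝ] E) Set.univ c := by
    rw [ApproximatesLinearOn.eq_1]
    intro x _ y _
    have := hg.dist_le_mul x y
    rw [dist_eq_norm, dist_eq_norm] at this
    have e : x + g x - (y + g y) - (x - y) = g x - g y := by abel
    exact (congrArg norm e).trans_le this
  -- In the zero space the identity has norm 0, so that case is separated.
  have hc' : Subsingleton E ∨
      c < ‖((ContinuousLinearEquiv.refl ℝ E).symm : E →L[ℝ] E)‖₊⁻¹ := by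
    rcases subsingleton_or_nontrivial E with hE | hE
    · exact Or.inl hE
    · right
      have : ‖((ContinuousLinearEquiv.refl ℝ E).symm : E →L[ℝ] E)‖₊ = 1 := by
        have : ((ContinuousLinearEquiv.refl ℝ E).symm : E →L[ℝ] E) = ContinuousLinearMap.id ℝ E :=
          rfl
        rw [this]
        exact NNReal.eq ContinuousLinearMap.norm_id
      rwa [this, inv_one]
  exact ⟨h.toHomeomorph _ hc', fun x => rfl⟩

end Perturbation

/-! ### Image densities and their entropy -/

section Densities

variable {d : ℕ} {q q' : Param d → ℝ}

lemma IsPosDensity.integrable (hq : IsPosDensity q) : Integrable q :=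
  Integrable.of_integral_ne_zero (by rw [hq.integral_eq_one]; exact one_ne_zero)

lemma IsPosDensity.lintegral_eq_one (hq : IsPosDensity q) : ∫⁻ θ, ENNReal.ofReal (q θ) = 1 := by
  rw [← ofReal_integral_eq_lintegral_ofReal hq.integrable
    (Filter.Eventually.of_forall fun θ => (hq.pos θ).le), hq.integral_eq_one, ENNReal.ofReal_one]

lemma IsPosDensity.of_lintegral_eq_one (hm : Measurable q) (hpos : ∀ θ, 0 < q θ)
    (h : ∫⁻ θ, ENNReal.ofReal (q θ) = 1) : IsPosDensity q :=
  ⟨hm, hpos, by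
    rw [integral_eq_lintegral_of_nonneg_ae (Filter.Eventually.of_forall fun θ => (hpos θ).le)
      hm.aestronglyMeasurable, h, ENNReal.toReal_one]⟩

lemma IsPosDensity.integrable_densityMeasure_iff (hq : IsPosDensity q) {g : Param d → ℝ} :
    Integrable g (densityMeasure q) ↔ Integrable fun θ => q θ * g θ := by
  rw [densityMeasure, integrable_withDensity_iff_integrable_smul' hq.measurable.ennreal_ofReal
    (Filter.Eventually.of_forall fun _ => ENNReal.ofReal_lt_top)]
  simp only [ENNReal.toReal_ofReal (hq.pos _).le, smul_eq_mul]

lemma IsPosDensity.integral_densityMeasure (hq : IsPosDensity q) (g : Param d → ℝ) :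
    ∫ θ, g θ ∂densityMeasure q = ∫ θ, q θ * g θ := by
  rw [densityMeasure, integral_withDensity_eq_integral_toReal_smul hq.measurable.ennreal_ofReal
    (Filter.Eventually.of_forall fun _ => ENNReal.ofReal_lt_top)]
  simp only [ENNReal.toReal_ofReal (hq.pos _).le, smul_eq_mul]

lemma IsPushforwardDensity.integrable_iff {T : Param d → Param d} (hq : IsPosDensity q)
    (h : IsPushforwardDensity T q q') (hT : Measurable T) {g : Param d → ℝ} (hg : Measurable g) :
    (Integrable fun θ => q' θ * g θ) ↔ Integrable fun θ => q θ * g (T θ) := by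
  rw [← h.1.integrable_densityMeasure_iff, ← h.2,
    integrable_map_measure hg.aestronglyMeasurable hT.aemeasurable,
    hq.integrable_densityMeasure_iff]
  rfl

lemma IsPushforwardDensity.integral_eq {T : Param d → Param d} (hq : IsPosDensity q)
    (h : IsPushforwardDensity T q q') (hT : Measurable T) {g : Param d → ℝ} (hg : Measurable g) :
    ∫ θ, q' θ * g θ = ∫ θ, q θ * g (T θ) := by
  rw [← h.1.integral_densityMeasure, ← h.2,
    integral_map hT.aemeasurable hg.aestronglyMeasurable, hq.integral_densityMeasure]

/-- Lets an arbitrary image density be replaced by the explicit one from the change of variables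
formula. -/
lemma IsPushforwardDensity.ae_eq {T : Param d → Param d} {q'' : Param d → ℝ}
    (h : IsPushforwardDensity T q q') (h' : IsPushforwardDensity T q q'') :
    q' =ᵐ[volume] q'' := by
  have e : densityMeasure q' = densityMeasure q'' := h.2.symm.trans h'.2
  rw [densityMeasure, densityMeasure, withDensity_eq_iff h.1.measurable.ennreal_ofReal.aemeasurable
    h'.1.measurable.ennreal_ofReal.aemeasurable
    (by rw [h.1.lintegral_eq_one]; exact ENNReal.one_ne_top)] at e
  filter_upwards [e] with θ hθ
  rwa [ENNReal.ofReal_eq_ofReal_iff (h.1.pos θ).le (h'.1.pos θ).le] at hθ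

variable {T : Param d ≃ₜ Param d} {T' : Param d → Param d →L[ℝ] Param d}

lemma measurable_det_of_hasFDerivAt (hT : ∀ θ, HasFDerivAt T (T' θ) θ) :
    Measurable fun θ => (T' θ).det := by
  have : T' = fderiv ℝ T := funext fun θ => (hT θ).fderiv.symm
  rw [this]
  exact ContinuousLinearMap.continuous_det.measurable.comp (measurable_fderiv ℝ T)

/-- The change of variables formula for the density of an image measure. -/
lemma isPushforwardDensity_div_det (hq : IsPosDensity q) (hT : ∀ θ, HasFDerivAt T (T' θ) θ)
    (hdet : ∀ θ, 0 < (T' θ).det) :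
    IsPushforwardDensity T q fun y => q (T.symm y) / (T' (T.symm y)).det := by
  have hm : Measurable fun y => q (T.symm y) / (T' (T.symm y)).det :=
    (hq.measurable.comp T.symm.continuous.measurable).div
      ((measurable_det_of_hasFDerivAt hT).comp T.symm.continuous.measurable)
  have hmap : (densityMeasure q).map T
      = densityMeasure fun y => q (T.symm y) / (T' (T.symm y)).det := by
    ext s hs
    have hs' : MeasurableSet (T ⁻¹' s) := T.continuous.measurable hs
    rw [Measure.map_apply T.continuous.measurable hs, densityMeasure, withDensity_apply _ hs',
      densityMeasure, withDensity_apply _ hs]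
    have := lintegral_image_eq_lintegral_abs_det_fderiv_mul volume hs'
      (fun θ _ => (hT θ).hasFDerivWithinAt) T.injective.injOn
      (fun y => ENNReal.ofReal (q (T.symm y) / (T' (T.symm y)).det))
    rw [Set.image_preimage_eq s T.surjective] at this
    rw [this]
    refine lintegral_congr fun θ => ?_
    rw [T.symm_apply_apply, ← ENNReal.ofReal_mul (abs_nonneg _), abs_of_pos (hdet θ),
      mul_div_cancel₀ _ (hdet θ).ne']
  refine ⟨IsPosDensity.of_lintegral_eq_one hm (fun y => div_pos (hq.pos _) (hdet _)) ?_, hmap⟩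
  have := congrArg (fun μ => μ Set.univ) hmap
  simp only [densityMeasure] at this
  rw [Measure.map_apply T.continuous.measurable MeasurableSet.univ, Set.preimage_univ,
    withDensity_apply _ MeasurableSet.univ, withDensity_apply _ MeasurableSet.univ,
    setLIntegral_univ, setLIntegral_univ, hq.lintegral_eq_one] at this
  exact this.symm

/-- The entropy of an image measure. -/
lemma IsPushforwardDensity.entropy (hq : IsPosDensity q)
    (hent : Integrable fun θ => q θ * Real.log (q θ)) (hT : ∀ θ, HasFDerivAt T (T' θ) θ)
    (hdet : ∀ θ, 0 < (T' θ).det) (hlog : Integrable fun θ => q θ * Real.log (T' θ).det)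
    (h : IsPushforwardDensity T q q') :
    (Integrable fun θ => q' θ * Real.log (q' θ)) ∧
      ∫ θ, q' θ * Real.log (q' θ)
        = (∫ θ, q θ * Real.log (q θ)) - ∫ θ, q θ * Real.log (T' θ).det := by
  have h₀ := isPushforwardDensity_div_det hq hT hdet
  set q₀ : Param d → ℝ := fun y => q (T.symm y) / (T' (T.symm y)).det with hq₀
  -- Only the logarithm is replaced: the weight q' stays, so the integral can be pulled back along
  -- T.
  have hae : (fun θ => q' θ * Real.log (q' θ)) =ᵐ[volume] fun θ => q' θ * Real.log (q₀ θ) := by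
    filter_upwards [h.ae_eq h₀] with θ hθ
    rw [hθ]
  have hpt : (fun θ => q θ * Real.log (q₀ (T θ)))
      = fun θ => q θ * Real.log (q θ) - q θ * Real.log (T' θ).det := by
    funext θ
    simp only [hq₀, T.symm_apply_apply]
    rw [Real.log_div (hq.pos θ).ne' (hdet θ).ne', mul_sub]
  have hmeas : Measurable fun θ => Real.log (q₀ θ) := h₀.1.measurable.log
  rw [integrable_congr hae, integral_congr_ae hae,
    h.integrable_iff hq T.continuous.measurable hmeas,
    h.integral_eq hq T.continuous.measurable hmeas, hpt]
  exact ⟨hent.sub hlog, integral_sub hent hlog⟩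

end Densities

/-! ### Gibbs' inequality and the factorised posterior -/

section Divergences

variable {d K : ℕ} {q p₀ : Param d → ℝ} {t : Fin K → Param d → ℝ}

/-- Pointwise Gibbs inequality, from log x ≤ x - 1. For two densities the left side is integrable
with integral zero. -/
lemma sub_le_mul_log_div {a b : ℝ} (ha : 0 < a) (hb : 0 < b) : a - b ≤ a * Real.log (a / b) := by
  have h := Real.log_le_sub_one_of_pos (div_pos hb ha)
  have e : Real.log (a / b) = -Real.log (b / a) := by rw [← Real.log_inv, inv_div]
  have h2 : a * Real.log (b / a) ≤ a * (b / a - 1) := mul_le_mul_of_nonneg_left h ha.le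
  have h3 : a * (b / a - 1) = b - a := by field_simp
  rw [e]
  linarith

/-- The K + 1 logarithms of q on the right combine into K log q + log(q / Q), with Q the posterior,
and Gibbs' inequality discards the last term. -/
lemma card_mul_entropy_le (hq : IsPosDensity q)
    (hent : Integrable fun θ => q θ * Real.log (q θ)) (hp₀ : IsPosDensity p₀)
    (ht : ∀ m θ, 0 < t m θ) (hpost : IsPosDensity (globalPosterior p₀ t))
    (hKL₀ : KLFinite q p₀) (hKL : ∀ m, KLFinite q (t m)) :
    K * ∫ θ, q θ * Real.log (q θ) ≤ KL q p₀ + ∑ m, KL q (t m) := by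
  have hpt : ∀ θ, K * (q θ * Real.log (q θ)) + (q θ - globalPosterior p₀ t θ)
      ≤ q θ * Real.log (q θ / p₀ θ) + ∑ m, q θ * Real.log (q θ / t m θ) := by
    intro θ
    have h := sub_le_mul_log_div (hq.pos θ) (hpost.pos θ)
    have e : q θ * Real.log (q θ / p₀ θ) + ∑ m, q θ * Real.log (q θ / t m θ)
        = K * (q θ * Real.log (q θ)) + q θ * Real.log (q θ / globalPosterior p₀ t θ) := by
      rw [Real.log_div (hq.pos θ).ne' (hp₀.pos θ).ne', Real.log_div (hq.pos θ).ne'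
        (hpost.pos θ).ne', globalPosterior, Real.log_mul (hp₀.pos θ).ne'
        (Finset.prod_pos fun m _ => ht m θ).ne', Real.log_prod fun m _ => (ht m θ).ne',
        ← Finset.mul_sum]
      have : ∑ m, Real.log (q θ / t m θ) = K * Real.log (q θ) - ∑ m, Real.log (t m θ) := by
        rw [Finset.sum_congr rfl fun m _ => Real.log_div (hq.pos θ).ne' (ht m θ).ne',
          Finset.sum_sub_distrib, Finset.sum_const, Finset.card_univ, Fintype.card_fin,
          nsmul_eq_mul]
      rw [this]
      ring
    rw [e]
    linarith
  have hsum : Integrable fun θ => ∑ m, q θ * Real.log (q θ / t m θ) :=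
    integrable_finsetSum _ fun m _ => hKL m
  have hsub : Integrable fun θ => q θ - globalPosterior p₀ t θ := hq.integrable.sub hpost.integrable
  have := integral_mono ((hent.const_mul (K : ℝ)).add hsub) (hKL₀.add hsum) hpt
  rw [integral_add' (hent.const_mul _) hsub, integral_add' hKL₀ hsum, integral_const_mul,
    integral_sub hq.integrable hpost.integrable, hq.integral_eq_one, hpost.integral_eq_one,
    integral_finsetSum _ fun m _ => hKL m] at this
  simpa [KL] using this

lemma normaliser_pos {f : Param d → ℝ} {c : ℝ} (hf : ∀ θ, 0 < f θ) (h : ∫ θ, f θ / c = 1) :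
    0 < c := by
  -- The case c = 0 is covered too: division by zero gives 0, so the integral could not be 1.
  by_contra hc
  have : ∫ θ, f θ / c ≤ 0 :=
    integral_nonpos fun θ => div_nonpos_of_nonneg_of_nonpos (hf θ).le (not_lt.1 hc)
  linarith

/-- With Q the posterior, Q / p₀ is the product of the factors, and Gibbs' inequality for Q against
`t m / C m` gives E_Q[log tₘ] ≤ E_Q[log Q] + log Cₘ. The same pointwise bound, with the lower bound
Q - p₀, yields finiteness. -/
lemma KL_le_card_mul_entropy_add_log (hp₀ : IsPosDensity p₀) (ht : ∀ m θ, 0 < t m θ)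
    (hpost : IsPosDensity (globalPosterior p₀ t))
    (hent : Integrable fun θ => globalPosterior p₀ t θ * Real.log (globalPosterior p₀ t θ))
    {C : Fin K → ℝ} (hC : ∀ m, ∫ θ, t m θ / C m = 1) :
    KLFinite (globalPosterior p₀ t) p₀ ∧ KL (globalPosterior p₀ t) p₀
      ≤ K * (∫ θ, globalPosterior p₀ t θ * Real.log (globalPosterior p₀ t θ))
        + Real.log (∏ m, C m) := by
  have hCpos : ∀ m, 0 < C m := fun m => normaliser_pos (ht m) (hC m)
  -- A non-integrable function would have integral 0, not 1.
  have htint : ∀ m, Integrable fun θ => t m θ / C m := fun m =>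
    Integrable.of_integral_ne_zero (by rw [hC m]; exact one_ne_zero)
  set Q := globalPosterior p₀ t with hQ
  set U : Param d → ℝ := fun θ => ∑ m, (Q θ * Real.log (Q θ) + Q θ * Real.log (C m)
    + (t m θ / C m - Q θ)) with hU
  have hi : ∀ m, Integrable fun θ => Q θ * Real.log (Q θ) + Q θ * Real.log (C m)
      + (t m θ / C m - Q θ) := fun m =>
    (hent.add (hpost.integrable.mul_const _)).add ((htint m).sub hpost.integrable)
  have hUint : Integrable U := integrable_finsetSum _ fun m _ => hi m
  have hupper : ∀ θ, Q θ * Real.log (Q θ / p₀ θ) ≤ U θ := by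
    intro θ
    have e : Q θ / p₀ θ = ∏ m, t m θ := by
      rw [hQ, globalPosterior, mul_div_cancel_left₀ _ (hp₀.pos θ).ne']
    rw [e, Real.log_prod fun m _ => (ht m θ).ne', Finset.mul_sum]
    refine Finset.sum_le_sum fun m _ => ?_
    have h := sub_le_mul_log_div (hpost.pos θ) (div_pos (ht m θ) (hCpos m))
    rw [Real.log_div (hpost.pos θ).ne' (div_pos (ht m θ) (hCpos m)).ne',
      Real.log_div (ht m θ).ne' (hCpos m).ne'] at h
    linarith
  have hlower : ∀ θ, Q θ - p₀ θ ≤ Q θ * Real.log (Q θ / p₀ θ) := fun θ =>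
    sub_le_mul_log_div (hpost.pos θ) (hp₀.pos θ)
  have hfin : KLFinite Q p₀ :=
    integrable_of_le_of_le
      (hpost.measurable.mul (hpost.measurable.div hp₀.measurable).log).aestronglyMeasurable
      (Filter.Eventually.of_forall hlower) (Filter.Eventually.of_forall hupper)
      (hpost.integrable.sub hp₀.integrable) hUint
  refine ⟨hfin, ?_⟩
  have := integral_mono hfin hUint hupper
  have hi' : ∀ m, ∫ θ, (Q θ * Real.log (Q θ) + Q θ * Real.log (C m) + (t m θ / C m - Q θ))
      = (∫ θ, Q θ * Real.log (Q θ)) + Real.log (C m) := by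
    intro m
    have i1 : Integrable fun θ => Q θ * Real.log (C m) := hpost.integrable.mul_const _
    have i2 : Integrable fun θ => Q θ * Real.log (Q θ) + Q θ * Real.log (C m) := hent.add i1
    have i3 : Integrable fun θ => t m θ / C m - Q θ := (htint m).sub hpost.integrable
    rw [integral_add i2 i3, integral_add hent i1,
      integral_mul_const, integral_sub (htint m) hpost.integrable, hpost.integral_eq_one, hC m]
    ring
  rw [hU, integral_finsetSum _ fun m _ => hi m, Finset.sum_congr rfl fun m _ => hi' m,
    Finset.sum_add_distrib, Finset.sum_const, Finset.card_univ, Fintype.card_fin,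
    nsmul_eq_mul, ← Real.log_prod fun m _ => (hCpos m).ne'] at this
  exact this

lemma globalPosterior_updateFactors (hpost : ∀ θ, globalPosterior p₀ t θ ≠ 0) (k : Fin K)
    (q' : Param d → ℝ) : globalPosterior p₀ (updateFactors p₀ t k q') = q' := by
  funext θ
  have h := hpost θ
  have e : ∏ m, updateFactors p₀ t k q' m θ
      = q' θ / globalPosterior p₀ t θ * ∏ m, t m θ := by
    rw [← Finset.mul_prod_erase _ _ (Finset.mem_univ k),
      ← Finset.mul_prod_erase _ (fun m => t m θ) (Finset.mem_univ k), ← mul_assoc]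
    congr 1
    · simp [updateFactors]
    · refine Finset.prod_congr rfl fun m hm => ?_
      simp [updateFactors, Function.update_of_ne (Finset.ne_of_mem_erase hm)]
  rw [globalPosterior, e, mul_left_comm]
  exact div_mul_cancel₀ _ h

lemma updateFactors_pos (ht : ∀ m θ, 0 < t m θ) (hpost : ∀ θ, 0 < globalPosterior p₀ t θ)
    (k : Fin K) {q' : Param d → ℝ} (hq' : ∀ θ, 0 < q' θ) (m : Fin K) (θ : Param d) :
    0 < updateFactors p₀ t k q' m θ := by
  by_cases h : m = k
  · subst h
    simpa [updateFactors] using mul_pos (div_pos (hq' θ) (hpost θ)) (ht m θ)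
  · simpa [updateFactors, Function.update_of_ne h] using ht m θ

end Divergences

/-! ### RKHS vector fields and the Stein identity -/

section Pairing

variable {d : ℕ} {H : Type*} [NormedAddCommGroup H] [InnerProductSpace ℝ H]

/-- The vector with coordinates `⟨w, φⱼ⟩`, for `w` in `H` and `φ` in `H^d`. -/
def pairing (φ : VectorRKHS d H) : H →L[ℝ] Param d :=
  ((PiLp.continuousLinearEquiv 2 ℝ fun _ : Fin d => ℝ).symm :
    (Fin d → ℝ) →L[ℝ] Param d).comp (ContinuousLinearMap.pi fun j => innerSL ℝ (φ j))

lemma pairing_apply (φ : VectorRKHS d H) (w : H) (j : Fin d) :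
    pairing φ w j = inner ℝ (φ j) w := rfl

end Pairing

section Kernel

variable {d : ℕ} {H : Type*} [NormedAddCommGroup H] [InnerProductSpace ℝ H] [CompleteSpace H]
  [RKHS ℝ H (Param d) ℝ]

lemma inner_kernelSection (θ : Param d) (f : H) : inner ℝ (kernelSection H θ) f = f θ := by
  simp [kernelSection]

lemma inner_kernelSection_kernelSection (θ θ' : Param d) :
    inner ℝ (kernelSection H θ) (kernelSection H θ') = scalarKernel H θ θ' := by
  rw [inner_kernelSection, kernelSection, RKHS.kerFun_apply, scalarKernel]

lemma RegularKernel.exists_hasFDerivAt (hH : RegularKernel (d := d) H) (θ : Param d) :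
    ∃ D : Param d →L[ℝ] H, HasFDerivAt (kernelSection H) D θ ∧
      ∀ u v, inner ℝ (D u) (D v)
        = mixedDeriv (fun z : Param d × Param d => scalarKernel H z.1 z.2) θ u v :=
  exists_hasFDerivAt_featureMap hH.1 inner_kernelSection_kernelSection θ

lemma RegularKernel.differentiable (hH : RegularKernel (d := d) H) :
    Differentiable ℝ (kernelSection H : Param d → H) := fun θ =>
  let ⟨_, hD, _⟩ := hH.exists_hasFDerivAt θ
  hD.differentiableAt

/-- The feature map of a regular kernel and its derivative are bounded. -/
lemma RegularKernel.exists_bound (hH : RegularKernel (d := d) H) :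
    ∃ S : ℝ, 0 ≤ S ∧ ∀ θ : Param d, ‖kernelSection H θ‖ ≤ S ∧
      ‖fderiv ℝ (kernelSection H) θ‖ ≤ S := by
  obtain ⟨M, hM⟩ := hH.2
  have hM0 : 0 ≤ M := (norm_nonneg _).trans (hM 0 (by norm_num) 0)
  -- The square root appears because the squared norms of the feature and of its directional
  -- derivatives are diagonal values of the kernel and of its mixed derivative.
  refine ⟨√M, Real.sqrt_nonneg M, fun θ => ⟨Real.le_sqrt_of_sq_le ?_, ?_⟩⟩
  · rw [← real_inner_self_eq_norm_sq, inner_kernelSection_kernelSection]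
    have := hM 0 (by norm_num) (θ, θ)
    rw [norm_iteratedFDeriv_zero] at this
    exact (le_abs_self _).trans this
  · obtain ⟨D, hD, hgram⟩ := hH.exists_hasFDerivAt θ
    rw [hD.fderiv]
    refine D.opNorm_le_bound (Real.sqrt_nonneg M) fun u => ?_
    refine le_of_sq_le_sq ?_ (by positivity)
    have h2 := hM 2 le_rfl (θ, θ)
    rw [← norm_iteratedFDeriv_fderiv, norm_iteratedFDeriv_one] at h2
    rw [mul_pow, Real.sq_sqrt hM0, ← real_inner_self_eq_norm_sq, hgram]
    calc _ ≤ _ := (le_abs_self _).trans (abs_mixedDeriv_le _ θ u u)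
      _ ≤ M * ‖u‖ * ‖u‖ := by gcongr
      _ = _ := by ring

/-- Bochner integration needs strong measurability, and H is not assumed separable. The derivative
is a pointwise limit of continuous difference quotients. -/
lemma stronglyMeasurable_fderiv_kernelSection (hH : RegularKernel (d := d) H) (u : Param d) :
    StronglyMeasurable fun θ => fderiv ℝ (kernelSection H) θ u := by
  have hc : Continuous (kernelSection H : Param d → H) := hH.differentiable.continuous
  have hlim : Filter.Tendsto (fun n : ℕ => ‖(n : ℝ)‖) Filter.atTop Filter.atTop := by
    simpa using tendsto_natCast_atTop_atTop (R := ℝ)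
  refine stronglyMeasurable_of_tendsto Filter.atTop
    (f := fun (n : ℕ) θ => (n : ℝ) • (kernelSection H (θ + (n : ℝ)⁻¹ • u) - kernelSection H θ))
    (fun n => ?_) (tendsto_pi_nhds.2 fun θ => ?_)
  · exact (by fun_prop : Continuous fun θ =>
      (n : ℝ) • (kernelSection H (θ + (n : ℝ)⁻¹ • u) - kernelSection H θ)).stronglyMeasurable
  · exact (hH.differentiable θ).hasFDerivAt.lim u hlim

/-- Every field is a fixed continuous linear map after the feature map, so it inherits
differentiability and bounds. -/
lemma vectorField_eq (φ : VectorRKHS d H) (θ : Param d) :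
    vectorField φ θ = pairing φ (kernelSection H θ) := by
  ext j
  rw [pairing_apply, real_inner_comm, inner_kernelSection]
  rfl

/-- The derivative of the vector field given by an element of `H^d`. -/
def vectorFieldDeriv (φ : VectorRKHS d H) (θ : Param d) : Param d →L[ℝ] Param d :=
  (pairing φ).comp (fderiv ℝ (kernelSection H) θ)

/-- The divergence of the vector field given by an element of `H^d`. -/
def divergence (φ : VectorRKHS d H) (θ : Param d) : ℝ :=
  ∑ j, vectorFieldDeriv φ θ (EuclideanSpace.single j 1) j

lemma hasFDerivAt_vectorField (hH : RegularKernel (d := d) H) (φ : VectorRKHS d H)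
    (θ : Param d) : HasFDerivAt (vectorField φ) (vectorFieldDeriv φ θ) θ := by
  have e : vectorField φ = fun θ => pairing φ (kernelSection H θ) := funext (vectorField_eq φ)
  rw [e]
  exact (pairing φ).hasFDerivAt.comp θ (hH.differentiable θ).hasFDerivAt

lemma continuous_vectorField (hH : RegularKernel (d := d) H) (φ : VectorRKHS d H) :
    Continuous (vectorField φ) :=
  continuous_iff_continuousAt.2 fun θ => (hasFDerivAt_vectorField hH φ θ).continuousAt

lemma measurable_divergence (hH : RegularKernel (d := d) H) (φ : VectorRKHS d H) :
    Measurable (divergence φ) := by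
  refine Finset.measurable_fun_sum _ fun j _ => ?_
  exact (((EuclideanSpace.proj j : Param d →L[ℝ] ℝ).comp
    (pairing φ)).continuous.comp_stronglyMeasurable
    (stronglyMeasurable_fderiv_kernelSection hH (EuclideanSpace.single j 1))).measurable

lemma exists_vectorField_bound (hH : RegularKernel (d := d) H) (φ : VectorRKHS d H) :
    ∃ V : ℝ, 0 ≤ V ∧ ∀ θ, ‖vectorField φ θ‖ ≤ V ∧ ‖vectorFieldDeriv φ θ‖ ≤ V := by
  obtain ⟨S, hS, hb⟩ := hH.exists_bound
  refine ⟨‖pairing φ‖ * S, by positivity, fun θ => ⟨?_, ?_⟩⟩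
  · rw [vectorField_eq]
    exact (pairing φ).le_opNorm_of_le (hb θ).1
  · refine (ContinuousLinearMap.opNorm_comp_le _ _).trans ?_
    gcongr
    exact (hb θ).2

lemma abs_divergence_le {φ : VectorRKHS d H} {V : ℝ} {θ : Param d}
    (hV : ‖vectorFieldDeriv φ θ‖ ≤ V) : |divergence φ θ| ≤ d * V := by
  refine (Finset.abs_sum_le_sum_abs _ _).trans ?_
  calc _ ≤ ∑ _j : Fin d, V := Finset.sum_le_sum fun j _ => by
        refine (PiLp.norm_apply_le (vectorFieldDeriv φ θ (EuclideanSpace.single j 1)) j).trans ?_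
        refine (ContinuousLinearMap.le_opNorm _ _).trans ?_
        simpa using hV
    _ = _ := by simp

lemma integrable_mul_divergence (hH : RegularKernel (d := d) H) (φ : VectorRKHS d H)
    {q : Param d → ℝ} (hq : IsPosDensity q) : Integrable fun θ => q θ * divergence φ θ := by
  obtain ⟨V, -, hV⟩ := exists_vectorField_bound hH φ
  exact hq.integrable.mul_bdd (c := d * V) (measurable_divergence hH φ).aestronglyMeasurable
    (Filter.Eventually.of_forall fun θ => abs_divergence_le (hV θ).2)

lemma integrable_mul_fderiv_vectorField (hH : RegularKernel (d := d) H) (φ : VectorRKHS d H)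
    {q L : Param d → ℝ} (hq : IsPosDensity q) (hL : AdmissibleLoss q L) :
    Integrable fun θ => q θ * fderiv ℝ L θ (vectorField φ θ) := by
  obtain ⟨V, hV0, hV⟩ := exists_vectorField_bound hH φ
  have hc : Continuous (fderiv ℝ L) := hL.contDiff.continuous_fderiv (by norm_num)
  refine (hL.integrable_fderiv.mul_const V).mono'
    (hq.measurable.mul (hc.clm_apply (continuous_vectorField hH φ)).measurable).aestronglyMeasurable
    (Filter.Eventually.of_forall fun θ => ?_)
  rw [norm_mul, Real.norm_of_nonneg (hq.pos θ).le, mul_assoc]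
  exact mul_le_mul_of_nonneg_left ((fderiv ℝ L θ).le_opNorm_of_le (hV θ).1) (hq.pos θ).le

lemma fderiv_log_likelihood {α : ℝ} {L : Param d → ℝ} (hL : Differentiable ℝ L) (θ : Param d) :
    fderiv ℝ (fun ϑ => Real.log (likelihood α L ϑ)) θ = -(α⁻¹ • fderiv ℝ L θ) := by
  simp only [likelihood, Real.log_exp]
  exact (((hL θ).hasFDerivAt.const_mul α⁻¹).neg).fderiv

/-- Needed to move inner products inside the Bochner integral. Boundedness of the feature map and
its derivative reduces domination to that of q‖∇L‖ and q. -/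
lemma integrable_svgd_integrand (hH : RegularKernel (d := d) H) {α : ℝ} {q L : Param d → ℝ}
    (hq : IsPosDensity q) (hL : AdmissibleLoss q L) (j : Fin d) :
    Integrable fun θ => q θ •
      (fderiv ℝ (fun ϑ => Real.log (likelihood α L ϑ)) θ (EuclideanSpace.single j 1)
          • kernelSection H θ
        + fderiv ℝ (fun ϑ => kernelSection H ϑ) θ (EuclideanSpace.single j 1)) := by
  obtain ⟨S, hS, hb⟩ := hH.exists_bound
  have hd : Differentiable ℝ L := hL.contDiff.differentiable (by norm_num)
  have hc : Continuous (fderiv ℝ L) := hL.contDiff.continuous_fderiv (by norm_num)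
  have hk : Continuous (kernelSection H : Param d → H) := hH.differentiable.continuous
  have hc' : Continuous fun θ =>
      (-(α⁻¹ • fderiv ℝ L θ) : Param d →L[ℝ] ℝ) (EuclideanSpace.single j 1) := by fun_prop
  simp only [fderiv_log_likelihood hd]
  have hdom : Integrable fun θ => |α⁻¹| * S * (q θ * ‖fderiv ℝ L θ‖) + S * q θ :=
    (hL.integrable_fderiv.const_mul _).add (hq.integrable.const_mul _)
  refine hdom.mono' ?_ (Filter.Eventually.of_forall fun θ => ?_)
  · exact (hq.measurable.stronglyMeasurable.smul ((hc'.smul hk).stronglyMeasurable.add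
      (stronglyMeasurable_fderiv_kernelSection hH _))).aestronglyMeasurable
  · rw [norm_smul, Real.norm_of_nonneg (hq.pos θ).le]
    have h1 : ‖(-(α⁻¹ • fderiv ℝ L θ) : Param d →L[ℝ] ℝ) (EuclideanSpace.single j 1)‖
        ≤ |α⁻¹| * ‖fderiv ℝ L θ‖ := by
      refine (ContinuousLinearMap.le_opNorm _ _).trans ?_
      rw [norm_neg, norm_smul]
      simp
    have h2 : ‖fderiv ℝ (fun ϑ => kernelSection H ϑ) θ (EuclideanSpace.single j 1)‖ ≤ S := by
      refine (ContinuousLinearMap.le_opNorm _ _).trans ?_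
      simpa using (hb θ).2
    have h3 := norm_add_le
      ((-(α⁻¹ • fderiv ℝ L θ) : Param d →L[ℝ] ℝ) (EuclideanSpace.single j 1) • kernelSection H θ)
      (fderiv ℝ (fun ϑ => kernelSection H ϑ) θ (EuclideanSpace.single j 1))
    rw [norm_smul] at h3
    have h4 := mul_le_mul h1 (hb θ).1 (norm_nonneg _) (by positivity)
    calc _ ≤ q θ * (|α⁻¹| * ‖fderiv ℝ L θ‖ * S + S) :=
          mul_le_mul_of_nonneg_left (by linarith) (hq.pos θ).le
      _ = _ := by ring

lemma sum_apply_single_mul {A : Param d →L[ℝ] ℝ} (v : Param d) :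
    ∑ j, A (EuclideanSpace.single j 1) * v j = A v := by
  conv_rhs => rw [← (EuclideanSpace.basisFun (Fin d) ℝ).sum_repr v, map_sum]
  refine Finset.sum_congr rfl fun j _ => ?_
  simp [mul_comm]

/-- The Stein identity: the inner product of a vector field with an SVGD update function. -/
lemma inner_svgdUpdate (hH : RegularKernel (d := d) H) {α : ℝ} {q L : Param d → ℝ}
    (hq : IsPosDensity q) (hL : AdmissibleLoss q L) (φ : VectorRKHS d H) :
    inner ℝ φ (svgdUpdate H q (likelihood α L))
      = -(α⁻¹ * ∫ θ, q θ * fderiv ℝ L θ (vectorField φ θ)) + ∫ θ, q θ * divergence φ θ := by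
  have hd : Differentiable ℝ L := hL.contDiff.differentiable (by norm_num)
  have hi := fun j => integrable_svgd_integrand hH (α := α) hq hL j
  have hi' := fun j => (hi j).const_inner (𝕜 := ℝ) (φ j)
  -- The reproducing property turns the two kernel terms into φⱼ(θ) and ∂ⱼφⱼ(θ); summing over j
  -- gives ∇L·φ and the divergence.
  have e : ∀ θ, ∑ j, inner ℝ (φ j) (q θ •
      (fderiv ℝ (fun ϑ => Real.log (likelihood α L ϑ)) θ (EuclideanSpace.single j 1)
          • kernelSection H θ
        + fderiv ℝ (fun ϑ => kernelSection H ϑ) θ (EuclideanSpace.single j 1)))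
      = -(α⁻¹ * (q θ * fderiv ℝ L θ (vectorField φ θ))) + q θ * divergence φ θ := by
    intro θ
    rw [← sum_apply_single_mul (vectorField φ θ), divergence, Finset.mul_sum, Finset.mul_sum,
      Finset.mul_sum, ← Finset.sum_neg_distrib, ← Finset.sum_add_distrib]
    refine Finset.sum_congr rfl fun j _ => ?_
    have h1 : vectorField φ θ j = inner ℝ (φ j) (kernelSection H θ) := by
      rw [vectorField_eq, pairing_apply]
    have h2 : vectorFieldDeriv φ θ (EuclideanSpace.single j 1) j
        = inner ℝ (φ j) (fderiv ℝ (fun ϑ => kernelSection H ϑ) θ (EuclideanSpace.single j 1)) := rfl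
    have h3 : (-(α⁻¹ • fderiv ℝ L θ) : Param d →L[ℝ] ℝ) (EuclideanSpace.single j 1)
        = -(α⁻¹ * fderiv ℝ L θ (EuclideanSpace.single j 1)) := rfl
    rw [h1, h2, inner_smul_right, inner_add_right, inner_smul_right, fderiv_log_likelihood hd, h3]
    ring
  rw [PiLp.inner_apply]
  simp only [svgdUpdate]
  rw [Finset.sum_congr rfl fun j _ => (integral_inner (𝕜 := ℝ) (hi j) (φ j)).symm,
    ← integral_finsetSum _ fun j _ => hi' j]
  simp only [e]
  have hneg : Integrable fun θ => -(α⁻¹ * (q θ * fderiv ℝ L θ (vectorField φ θ))) :=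
    ((integrable_mul_fderiv_vectorField hH φ hq hL).const_mul _).neg
  rw [integral_add hneg (integrable_mul_divergence hH φ hq), integral_neg, integral_const_mul]

end Kernel

/-! ### First-order expansions along one SVGD step -/

section Step

variable {d K : ℕ} {H : Type*} [NormedAddCommGroup H] [InnerProductSpace ℝ H] [CompleteSpace H]
  [RKHS ℝ H (Param d) ℝ]

/-- First-order expansion, with a quadratic error, of the expected loss along a step. -/
lemma IsPushforwardDensity.loss_le (hH : RegularKernel (d := d) H) {φ : VectorRKHS d H}
    {q q' L G : Param d → ℝ} {ε V r : ℝ} (hq : IsPosDensity q) (hL : AdmissibleLoss q L)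
    (hG : Integrable fun θ => q θ * G θ)
    (hGr : ∀ θ h : Param d, ‖h‖ ≤ r → ‖iteratedFDeriv ℝ 2 L (θ + h)‖ ≤ G θ)
    (hV : ∀ θ, ‖vectorField φ θ‖ ≤ V) (hε : 0 ≤ ε) (hεV : ε * V ≤ r)
    (h : IsPushforwardDensity (svgdStep ε φ) q q') :
    (Integrable fun θ => q' θ * L θ) ∧
      ∫ θ, q' θ * L θ ≤ (∫ θ, q θ * L θ)
        + ε * (∫ θ, q θ * fderiv ℝ L θ (vectorField φ θ))
        + ε ^ 2 * (V ^ 2 * ∫ θ, q θ * G θ) := by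
  have hv := continuous_vectorField hH φ
  have hT : Continuous (svgdStep ε φ) := by unfold svgdStep; fun_prop
  have hLc : Continuous L := hL.contDiff.continuous
  have hi := integrable_mul_fderiv_vectorField hH φ hq hL
  have key : ∀ θ, |L (svgdStep ε φ θ) - L θ - ε * fderiv ℝ L θ (vectorField φ θ)|
      ≤ ε ^ 2 * (V ^ 2 * G θ) := by
    intro θ
    have hn : ‖ε • vectorField φ θ‖ ≤ ε * V := by
      rw [norm_smul, Real.norm_of_nonneg hε]
      exact mul_le_mul_of_nonneg_left (hV θ) hε
    have h1 := norm_taylor_le_of_hessian_le hL.contDiff (hGr θ) (hn.trans hεV)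
    rw [map_smul, smul_eq_mul, Real.norm_eq_abs] at h1
    have hG0 : 0 ≤ G θ := (norm_nonneg _).trans (hGr θ _ (hn.trans hεV))
    calc _ ≤ _ := h1
      _ ≤ G θ * (ε * V) ^ 2 := by gcongr
      _ = _ := by ring
  set U : Param d → ℝ := fun θ => q θ * L θ + ε * (q θ * fderiv ℝ L θ (vectorField φ θ)) with hU
  set R : Param d → ℝ := fun θ => ε ^ 2 * (V ^ 2 * (q θ * G θ)) with hR
  have hUi : Integrable U := hL.integrable.add (hi.const_mul _)
  have hRi : Integrable R := (hG.const_mul _).const_mul _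
  -- The lower bound serves integrability only; the estimate uses the upper one.
  have hlo : ∀ θ, U θ - R θ ≤ q θ * L (svgdStep ε φ θ) := by
    intro θ
    have := mul_le_mul_of_nonneg_left (abs_le.1 (key θ)).1 (hq.pos θ).le
    simp only [hU, hR]
    linarith
  have hup : ∀ θ, q θ * L (svgdStep ε φ θ) ≤ U θ + R θ := by
    intro θ
    have := mul_le_mul_of_nonneg_left (abs_le.1 (key θ)).2 (hq.pos θ).le
    simp only [hU, hR]
    linarith
  have hint : Integrable fun θ => q θ * L (svgdStep ε φ θ) :=
    integrable_of_le_of_le (hq.measurable.mul (hLc.comp hT).measurable).aestronglyMeasurable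
      (Filter.Eventually.of_forall hlo) (Filter.Eventually.of_forall hup)
      (hUi.sub hRi) (hUi.add hRi)
  refine ⟨(h.integrable_iff hq hT.measurable hLc.measurable).2 hint, ?_⟩
  rw [h.integral_eq hq hT.measurable hLc.measurable]
  have := integral_mono hint (hUi.add hRi) hup
  rw [integral_add' hUi hRi, hU, hR, integral_add hL.integrable (hi.const_mul _),
    integral_const_mul, integral_const_mul, integral_const_mul] at this
  exact this

/-- For small steps an SVGD step is a homeomorphism, and image densities exist; the entropy has a
first-order expansion with a quadratic error. -/
lemma exists_pushforwardDensity_and_entropy_le (hH : RegularKernel (d := d) H)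
    {φ : VectorRKHS d H} {q : Param d → ℝ} {ε V δ C : ℝ} (hq : IsPosDensity q)
    (hent : Integrable fun θ => q θ * Real.log (q θ))
    (hV0 : 0 ≤ V) (hV : ∀ θ, ‖vectorFieldDeriv φ θ‖ ≤ V) (hC : 0 ≤ C)
    (hdet : ∀ A : Param d →L[ℝ] Param d, ‖A‖ ≤ δ → 0 < (1 + A).det ∧
        |Real.log (1 + A).det - ∑ j, A (EuclideanSpace.single j 1) j| ≤ C * ‖A‖ ^ 2)
    (hε : 0 ≤ ε) (hεV : ε * V < 1) (hεδ : ε * V ≤ δ) :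
    (∃ q', IsPushforwardDensity (svgdStep ε φ) q q') ∧
      ∀ q', IsPushforwardDensity (svgdStep ε φ) q q' →
        (Integrable fun θ => q' θ * Real.log (q' θ)) ∧
          ∫ θ, q' θ * Real.log (q' θ) ≤ (∫ θ, q θ * Real.log (q θ))
            - ε * (∫ θ, q θ * divergence φ θ) + ε ^ 2 * (C * V ^ 2) := by
  have hder : ∀ θ, HasFDerivAt (fun θ => ε • vectorField φ θ) (ε • vectorFieldDeriv φ θ) θ :=
    fun θ => (hasFDerivAt_vectorField hH φ θ).const_smul ε
  have hnorm : ∀ θ, ‖ε • vectorFieldDeriv φ θ‖ ≤ ε * V := by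
    intro θ
    rw [norm_smul, Real.norm_of_nonneg hε]
    exact mul_le_mul_of_nonneg_left (hV θ) hε
  -- As εV < 1, the displacement is a strict contraction and the step is a homeomorphism.
  have hlip : LipschitzWith ⟨ε * V, by positivity⟩ fun θ => ε • vectorField φ θ :=
    lipschitzWith_of_nnnorm_fderiv_le (fun θ => (hder θ).differentiableAt) fun θ => by
      rw [(hder θ).fderiv]
      exact hnorm θ
  obtain ⟨e, he⟩ := exists_homeomorph_of_id_add hlip hεV
  have heq : svgdStep ε φ = e := funext fun θ => (he θ).symm
  have hT : ∀ θ, HasFDerivAt e (1 + ε • vectorFieldDeriv φ θ) θ := by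
    intro θ
    rw [← heq]
    exact (hasFDerivAt_id θ).add (hder θ)
  have hpos : ∀ θ, 0 < (1 + ε • vectorFieldDeriv φ θ).det := fun θ =>
    (hdet _ ((hnorm θ).trans hεδ)).1
  have hlog : ∀ θ, |Real.log (1 + ε • vectorFieldDeriv φ θ).det - ε * divergence φ θ|
      ≤ ε ^ 2 * (C * V ^ 2) := by
    intro θ
    have h1 := (hdet _ ((hnorm θ).trans hεδ)).2
    have h2 : ∑ j, (ε • vectorFieldDeriv φ θ) (EuclideanSpace.single j 1) j
        = ε * divergence φ θ := by
      rw [divergence, Finset.mul_sum]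
      rfl
    rw [h2] at h1
    calc _ ≤ _ := h1
      _ ≤ C * (ε * V) ^ 2 := by gcongr; exact hnorm θ
      _ = _ := by ring
  have hdivint := integrable_mul_divergence hH φ hq
  have hlogint : Integrable fun θ => q θ * Real.log (1 + ε • vectorFieldDeriv φ θ).det := by
    have h1 : Integrable fun θ => q θ *
        (Real.log (1 + ε • vectorFieldDeriv φ θ).det - ε * divergence φ θ) :=
      hq.integrable.mul_bdd (c := ε ^ 2 * (C * V ^ 2))
        ((measurable_det_of_hasFDerivAt hT).log.sub
          ((measurable_divergence hH φ).const_mul ε)).aestronglyMeasurable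
        (Filter.Eventually.of_forall hlog)
    refine (h1.add (hdivint.const_mul ε)).congr (Filter.Eventually.of_forall fun θ => ?_)
    simp only [Pi.add_apply]
    ring
  rw [heq]
  refine ⟨⟨_, isPushforwardDensity_div_det hq hT hpos⟩, fun q' h => ?_⟩
  obtain ⟨h1, h2⟩ := h.entropy hq hent hT hpos hlogint
  refine ⟨h1, ?_⟩
  -- A lower bound suffices: log det enters the new entropy with a minus sign.
  have hlow : ∀ θ, ε * (q θ * divergence φ θ) - ε ^ 2 * (C * V ^ 2) * q θ
      ≤ q θ * Real.log (1 + ε • vectorFieldDeriv φ θ).det := by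
    intro θ
    have := mul_le_mul_of_nonneg_left (abs_le.1 (hlog θ)).1 (hq.pos θ).le
    linarith
  have h3 := integral_mono ((hdivint.const_mul ε).sub (hq.integrable.const_mul _)) hlogint hlow
  rw [integral_sub' (hdivint.const_mul ε) (hq.integrable.const_mul _), integral_const_mul,
    integral_const_mul, hq.integral_eq_one] at h3
  rw [h2]
  linarith

end Step

end FedBayes

end

/-! ### Assembly of the descent estimate -/

theorem lemma2 {d K : ℕ} {H : Type*} [NormedAddCommGroup H] [InnerProductSpace ℝ H]
    [CompleteSpace H] [RKHS ℝ H (FedBayes.Param d) ℝ]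
    (hH : FedBayes.RegularKernel (d := d) H)
    (α : ℝ) (hα : 0 < α) (L : Fin K → FedBayes.Param d → ℝ)
    (q : FedBayes.Param d → ℝ) (hq : FedBayes.IsPosDensity q)
    (hq_entropy : MeasureTheory.Integrable fun θ => q θ * Real.log (q θ))
    (hL : ∀ m, FedBayes.AdmissibleLoss q (L m))
    (φ : Fin K → FedBayes.VectorRKHS d H)
    (hφ : ∀ m, φ m = FedBayes.svgdUpdate H q (FedBayes.likelihood α (L m)))
    (k : Fin K) :
    ∃ ε₀ B : ℝ, 0 < ε₀ ∧ ∀ ε : ℝ, 0 < ε → ε < ε₀ →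
      (∃ q', FedBayes.IsPushforwardDensity (FedBayes.svgdStep ε (φ k)) q q') ∧
      ∀ q', FedBayes.IsPushforwardDensity (FedBayes.svgdStep ε (φ k)) q q' →
        ∀ (p₀ : FedBayes.Param d → ℝ) (t : Fin K → FedBayes.Param d → ℝ) (C : Fin K → ℝ),
          FedBayes.IsPosDensity p₀ →
          (∀ m, Measurable (t m)) → (∀ m θ, 0 < t m θ) →
          FedBayes.IsPosDensity (FedBayes.globalPosterior p₀ t) →
          FedBayes.KLFinite q p₀ →
          (∀ m, FedBayes.KLFinite q (t m)) →
          (∀ m, ∫ θ, FedBayes.updateFactors p₀ t k q' m θ / C m = 1) →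
          FedBayes.FreeEnergyFinite L p₀ q' ∧
            (FedBayes.freeEnergy α L p₀ q' - FedBayes.freeEnergy α L p₀ q) / α
              ≤ -ε * ∑ m, inner ℝ (φ k) (φ m) + ∑ m, FedBayes.KL q (t m)
                + Real.log (∏ m, C m) + B * ε ^ 2 := by
  open FedBayes in
  obtain ⟨V, hV0, hV⟩ := exists_vectorField_bound hH (φ k)
  obtain ⟨δ, hδ, c, hc, hdet⟩ := exists_abs_log_det_sub_trace_le d
  choose r hr G hG hGr using fun m => (hL m).hessian_dominated
  -- The three conditions give invertibility of the step, validity of the log det expansion, and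
  -- displacements within the Hessian radii.
  have hsmall : ∀ᶠ ε : ℝ in nhds 0, ε * V < 1 ∧ ε * V < δ ∧ ∀ m, ε * V < r m := by
    have ht : Filter.Tendsto (fun ε : ℝ => ε * V) (nhds 0) (nhds 0) := by
      simpa using (continuous_mul_const V).tendsto (0 : ℝ)
    exact (ht.eventually_lt_const one_pos).and ((ht.eventually_lt_const hδ).and
      (Filter.eventually_all.2 fun m => ht.eventually_lt_const (hr m)))
  obtain ⟨ε₀, hε₀, hsmall⟩ := Metric.eventually_nhds_iff.1 hsmall
  -- In B, the first term collects the Taylor errors of the losses, the second the log det errors of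
  -- the K entropies. Both are fixed before the prior and the factors.
  refine ⟨ε₀, α⁻¹ * (∑ m, V ^ 2 * ∫ θ, q θ * G m θ) + K * (c * V ^ 2), hε₀,
    fun ε hε hεε₀ => ?_⟩
  obtain ⟨hε1, hεδ, hεr⟩ := hsmall (y := ε) (by
    rwa [dist_zero_right, Real.norm_of_nonneg hε.le])
  obtain ⟨hex, hentropy⟩ := exists_pushforwardDensity_and_entropy_le hH hq hq_entropy hV0
    (fun θ => (hV θ).2) hc hdet hε.le hε1 hεδ.le
  refine ⟨hex, fun q' hq' p₀ t C hp₀ _ ht hpost hKL₀ hKL hC => ?_⟩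
  obtain ⟨hent', hent_le⟩ := hentropy q' hq'
  have hloss := fun m => hq'.loss_le hH hq (hL m) (hG m) (hGr m) (fun θ => (hV θ).1) hε.le
    (hεr m).le
  have hnew := globalPosterior_updateFactors (fun θ => (hpost.pos θ).ne') k q'
  obtain ⟨hfin, hKL'⟩ := KL_le_card_mul_entropy_add_log (t := updateFactors p₀ t k q') hp₀
    (updateFactors_pos ht hpost.pos k hq'.1.pos) (by rw [hnew]; exact hq'.1)
    (by rw [hnew]; exact hent') hC
  rw [hnew] at hfin hKL'
  refine ⟨⟨fun m => (hloss m).1, hfin⟩, ?_⟩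
  have hprior := card_mul_entropy_le hq hq_entropy hp₀ ht hpost hKL₀ hKL
  have hinner : ∑ m, inner ℝ (φ k) (φ m)
      = -(α⁻¹ * ∑ m, ∫ θ, q θ * fderiv ℝ (L m) θ (vectorField (φ k) θ))
        + K * ∫ θ, q θ * divergence (φ k) θ := by
    rw [Finset.sum_congr rfl fun m _ => (congrArg (inner ℝ (φ k)) (hφ m)).trans
      (inner_svgdUpdate hH hq (hL m) (φ k)), Finset.sum_add_distrib, Finset.sum_neg_distrib,
      ← Finset.mul_sum, Finset.sum_const, Finset.card_univ, Fintype.card_fin, nsmul_eq_mul]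
  have hsum := Finset.sum_le_sum fun m (_ : m ∈ Finset.univ) => (hloss m).2
  rw [Finset.sum_add_distrib, Finset.sum_add_distrib, ← Finset.mul_sum, ← Finset.mul_sum] at hsum
  have hsum' := mul_le_mul_of_nonneg_left hsum (inv_pos.2 hα).le
  have hent_mul := mul_le_mul_of_nonneg_left hent_le (Nat.cast_nonneg (α := ℝ) K)
  have hF : (freeEnergy α L p₀ q' - freeEnergy α L p₀ q) / α
      = α⁻¹ * (∑ m, ∫ θ, q' θ * L m θ) - α⁻¹ * (∑ m, ∫ θ, q θ * L m θ)
        + KL q' p₀ - KL q p₀ := by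
    unfold freeEnergy
    field_simp
    ring
  rw [hF, hinner]
  linarith
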